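/- Let $\Theta\subseteq\mathbb R^k$ and $\Lambda\subseteq\mathbb R^m$ be open, let $\{f_\theta\}_{\theta\in\Theta}$ be Lebesgue densities on $\mathbb R$, and let $\{h_\eta\}_{\eta\in\Lambda}$ be Lebesgue densities on $\mathbb R$ with mean zero and finite positive variance. Put $$g(y;(\theta,\eta))=\int_{\mathbb R} f_\theta(s)\,h_\eta(y-s)\,ds ,$$ let $G_{\theta,\eta}$ be the probability measure with density $g(\cdot;(\theta,\eta))$, and let $G^n_{\theta,\eta}$ be its $n$-fold product. Define the score functions $$\dot l_\theta=\frac{\nabla_\theta\, g(\cdot;(\theta,\eta))}{g(\cdot;(\theta,\eta))}\,1_{[g>0]},\qquad \dot l_\eta=\frac{\nabla_\eta\, g(\cdot;(\theta,\eta))}{g(\cdot;(\theta,\eta))}\,1_{[g>0]},\qquad \dot l_{\theta,\eta}=(\dot l_\theta,\dot l_\eta),$$ viewed as column vectors, and the Fisher information $I(\theta,\eta)=\int \dot l_{\theta,\eta}\,\dot l_{\theta,\eta}^{\,T}\,dG_{\theta,\eta}$, with blocks $I_{11},I_{12},I_{21},I_{22}$ corresponding to $\theta$ and $\eta$. Assume: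 * **A1**: for Lebesgue-almost every $y$, the map $(\theta,\eta)\mapsto g(y;(\theta,\eta))$ is continuously differentiable on $\Theta\times\Lambda$; * **A2**: $|\dot l_{\theta,\eta}|\in L_2(G_{\theta,\eta})$ for all $(\theta,\eta)\in\Theta\times\Lambda$; * **A3**: $I(\theta,\eta)$ is nonsingular for all $(\theta,\eta)\in\Theta\times\Lambda$ and continuous in $(\theta,\eta)$. Let $(\theta_0,\eta_0)\in\Theta\times\Lambda$, and define the efficient score and the efficient information for $\theta$ at $(\theta_0,\eta_0)$ by $$l^*_{\theta_0}=\dot l_{\theta_0}-I_{12}(\theta_0,\eta_0)\,I_{22}(\theta_0,\eta_0)^{-1}\,\dot l_{\eta_0},\qquad I^*_{\theta_0}=\int l^*_{\theta_0}\,l_{\theta_0}^{*\,T}\,dG_{\theta_0,\eta_0}.$$ For each $n$ let $l^*_j=l^*_{j,n}(Y_1,\dots,Y_n)\in\mathbb R^k$ $(1\le j\le n)$ and $\widehat L=\widehat L_n(Y_1,\dots,Y_n)\in\mathbb R^{k\times k}$ be measurable functions of the data such that, for every $\varepsilon>0$, as $n\to\infty$, $$G^n_{\theta_0,\eta_0}\Bigl(\tfrac1{\sqrt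 n}\,\Bigl\|\sum_{j=1}^n\bigl(l^*_j-l^*_{\theta_0}(Y_j)\bigr)\Bigr\|\ge\varepsilon\Bigr)\to0 \quad\text{and}\quad G^n_{\theta_0,\eta_0}\bigl(\|\widehat L-(I^*_{\theta_0})^{-1}\|\ge\varepsilon\bigr)\to 0 ,$$ where $\|\cdot\|$ denotes the Euclidean norm of a vector, respectively of a matrix. Suppose that $Y_i=X_i+\varepsilon_i$, $i=1,2,\dots$, where the pairs $(X_i,\varepsilon_i)$ are independent over $i$, and for each $i$ the variables $X_i$ and $\varepsilon_i$ are independent with densities $f_{\theta_0}$ and $h_{\eta_0}$ respectively (that is, the null hypothesis $H_0:\theta=\theta_0$ holds and $\eta_0$ is the true nuisance parameter). Then the efficient score statistic $$W_k=\Bigl\{\tfrac1{\sqrt n}\sum_{j=1}^n l^*_j\Bigr\}^{T}\,\widehat L\,\Bigl\{\tfrac1{\sqrt n}\sum_{j=1}^n l^*_j\Bigr\}$$ converges in distribution, as $n\to\infty$, to the central chi-square distribution $\chi^2_k$ with $k$ degrees of freedom. -/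

import Mathlib

open MeasureTheory ProbabilityTheory Filter Topology

noncomputable section

namespace Deconvolution

/-- `p` is a probability density on `ℝ` with respect to Lebesgue measure. -/
structure IsDensity (p : ℝ → ℝ) : Prop where
  measurable : Measurable p
  nonneg : ∀ x, 0 ≤ p x
  integrable : Integrable p
  integral_eq_one : ∫ x, p x = 1

/-- The measure on `ℝ` with Lebesgue density `p`. -/
def densityMeasure (p : ℝ → ℝ) : Measure ℝ :=
  volume.withDensity fun x => ENNReal.ofReal (p x)

/-- The composite deconvolution model: one observes `Y = X + ε` where `X` has a density `f θ`,
`θ ∈ Θ ⊆ ℝᵏ`, and the independent noise `ε` has a density `h η`, `η ∈ Λ ⊆ ℝᵐ`, with mean zero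
and finite positive variance. The parameter sets are open, so that derivatives with
respect to the parameters make sense. -/
structure Model (k m : ℕ) where
  /-- the set of values of the parameter of interest -/
  Θ : Set (EuclideanSpace ℝ (Fin k))
  /-- the set of values of the nuisance parameter -/
  Λ : Set (EuclideanSpace ℝ (Fin m))
  /-- the densities of the signal `X` -/
  f : EuclideanSpace ℝ (Fin k) → ℝ → ℝ
  /-- the densities of the noise `ε` -/
  h : EuclideanSpace ℝ (Fin m) → ℝ → ℝ
  isOpen_Θ : IsOpen Θ
  isOpen_Λ : IsOpen Λ
  isDensity_f : ∀ θ ∈ Θ, IsDensity (f θ)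
  isDensity_h : ∀ η ∈ Λ, IsDensity (h η)
  noise_mean : ∀ η ∈ Λ, ∫ x, x * h η x = 0
  noise_sq_integrable : ∀ η ∈ Λ, Integrable fun x => x ^ 2 * h η x
  noise_var_pos : ∀ η ∈ Λ, 0 < ∫ x, x ^ 2 * h η x

namespace Model

variable {k m : ℕ}

/-- The density `g(y; (θ, η)) = ∫ f_θ(s) h_η(y - s) ds` of an observation `Y`. -/
def g (M : Model k m) (θ : EuclideanSpace ℝ (Fin k)) (η : EuclideanSpace ℝ (Fin m))
    (y : ℝ) : ℝ :=
  ∫ s, M.f θ s * M.h η (y - s)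

/-- The distribution `G_{θ, η}` of an observation `Y`. -/
def G (M : Model k m) (θ : EuclideanSpace ℝ (Fin k)) (η : EuclideanSpace ℝ (Fin m)) :
    Measure ℝ :=
  densityMeasure (M.g θ η)

/-- The score function for `θ` at `(θ, η)`. -/
def scoreθ (M : Model k m) (θ : EuclideanSpace ℝ (Fin k)) (η : EuclideanSpace ℝ (Fin m))
    (y : ℝ) : EuclideanSpace ℝ (Fin k) :=
  {y | 0 < M.g θ η y}.indicator
    (fun y => (M.g θ η y)⁻¹ • gradient (fun θ' => M.g θ' η y) θ) y

/-- The score function for `η` at `(θ, η)`. -/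
def scoreη (M : Model k m) (θ : EuclideanSpace ℝ (Fin k)) (η : EuclideanSpace ℝ (Fin m))
    (y : ℝ) : EuclideanSpace ℝ (Fin m) :=
  {y | 0 < M.g θ η y}.indicator
    (fun y => (M.g θ η y)⁻¹ • gradient (fun η' => M.g θ η' y) η) y

/-- The score function `(l̇_θ, l̇_η)` for the full parameter `(θ, η)`. -/
def score (M : Model k m) (θ : EuclideanSpace ℝ (Fin k)) (η : EuclideanSpace ℝ (Fin m))
    (y : ℝ) : EuclideanSpace ℝ (Fin k ⊕ Fin m) :=
  WithLp.toLp 2 (Sum.elim (M.scoreθ θ η y) (M.scoreη θ η y))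

/-- The Fisher information matrix `I(θ, η)` of the full parameter. -/
def fisherInfo (M : Model k m) (θ : EuclideanSpace ℝ (Fin k))
    (η : EuclideanSpace ℝ (Fin m)) : Matrix (Fin k ⊕ Fin m) (Fin k ⊕ Fin m) ℝ :=
  Matrix.of fun a b => ∫ y, M.score θ η y a * M.score θ η y b ∂(M.G θ η)

/-- The regularity conditions: `A1` the densities are continuously differentiable in the parameter,
`A2` the scores are square integrable, `A3` the Fisher information is nonsingular and continuous. -/
structure IsRegular (M : Model k m) : Prop where
  A1 : ∀ᵐ y : ℝ, ContDiffOn ℝ 1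
    (fun p : EuclideanSpace ℝ (Fin k) × EuclideanSpace ℝ (Fin m) => M.g p.1 p.2 y)
    (M.Θ ×ˢ M.Λ)
  A2 : ∀ θ ∈ M.Θ, ∀ η ∈ M.Λ, MemLp (M.score θ η) 2 (M.G θ η)
  A3_nonsingular : ∀ θ ∈ M.Θ, ∀ η ∈ M.Λ, IsUnit (M.fisherInfo θ η).det
  A3_continuous : ContinuousOn
    (fun p : EuclideanSpace ℝ (Fin k) × EuclideanSpace ℝ (Fin m) => M.fisherInfo p.1 p.2)
    (M.Θ ×ˢ M.Λ)

/-- The efficient score function `l* = l̇_θ - I₁₂ I₂₂⁻¹ l̇_η` for `θ`. -/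
def effScore (M : Model k m) (θ : EuclideanSpace ℝ (Fin k)) (η : EuclideanSpace ℝ (Fin m))
    (y : ℝ) : EuclideanSpace ℝ (Fin k) :=
  M.scoreθ θ η y - WithLp.toLp 2 (Matrix.mulVec
    ((M.fisherInfo θ η).toBlocks₁₂ * ((M.fisherInfo θ η).toBlocks₂₂)⁻¹)
    (WithLp.ofLp (M.scoreη θ η y)))

/-- The efficient Fisher information matrix for `θ`. -/
def effInfo (M : Model k m) (θ : EuclideanSpace ℝ (Fin k)) (η : EuclideanSpace ℝ (Fin m)) :
    Matrix (Fin k) (Fin k) ℝ :=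
  Matrix.of fun a b => ∫ y, M.effScore θ η y a * M.effScore θ η y b ∂(M.G θ η)

/-- The joint distribution `Gⁿ_{θ, η}` of `n` independent observations. -/
def Gn (M : Model k m) (θ : EuclideanSpace ℝ (Fin k)) (η : EuclideanSpace ℝ (Fin m))
    (n : ℕ) : Measure (Fin n → ℝ) :=
  Measure.pi fun _ => M.G θ η

/-- The estimated scores `lhat n y j`, functions of the data `y = (y_1, …, y_n)`, are sufficiently
good at `(θ, η)`: the normalized sum `n^{-1/2} ∑ⱼ (lhat n y j - l*(y_j))` tends to zero in
`Gⁿ_{θ, η}`-probability. -/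
def IsSufficientlyGood (M : Model k m) (θ : EuclideanSpace ℝ (Fin k))
    (η : EuclideanSpace ℝ (Fin m))
    (lhat : (n : ℕ) → (Fin n → ℝ) → Fin n → EuclideanSpace ℝ (Fin k)) : Prop :=
  ∀ ε : ℝ, 0 < ε → Tendsto
    (fun n : ℕ => M.Gn θ η n
      {y | ε ≤ (1 / √(n : ℝ)) * ‖∑ j, (lhat n y j - M.effScore θ η (y j))‖})
    atTop (𝓝 0)

/-- `Lhat n`, a function of `n` observations, is a consistent estimate of the inverse efficient
information at `(θ, η)` (in the Euclidean matrix norm). -/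
def IsConsistent (M : Model k m) (θ : EuclideanSpace ℝ (Fin k))
    (η : EuclideanSpace ℝ (Fin m))
    (Lhat : (n : ℕ) → (Fin n → ℝ) → Matrix (Fin k) (Fin k) ℝ) : Prop :=
  ∀ ε : ℝ, 0 < ε → Tendsto
    (fun n : ℕ => M.Gn θ η n
      {y | ε ≤ √(∑ a, ∑ b, (Lhat n y a b - (M.effInfo θ η)⁻¹ a b) ^ 2)})
    atTop (𝓝 0)

end Model

/-- The efficient score test statistic
`W_k = {n^{-1/2} ∑ⱼ lhatⱼ} Lhat {n^{-1/2} ∑ⱼ lhatⱼ}ᵀ` computed from the data `y`. -/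
def effScoreStatistic {k : ℕ}
    (lhat : (n : ℕ) → (Fin n → ℝ) → Fin n → EuclideanSpace ℝ (Fin k))
    (Lhat : (n : ℕ) → (Fin n → ℝ) → Matrix (Fin k) (Fin k) ℝ)
    (n : ℕ) (y : Fin n → ℝ) : ℝ :=
  dotProduct (WithLp.ofLp ((1 / √(n : ℝ)) • ∑ j, lhat n y j))
    (Matrix.mulVec (Lhat n y) (WithLp.ofLp ((1 / √(n : ℝ)) • ∑ j, lhat n y j)))

/-- The central chi-square distribution with `k` degrees of freedom: the law of the sum of
squares of `k` independent standard normal variables. -/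
def chiSquare (k : ℕ) : Measure ℝ :=
  (Measure.pi fun _ : Fin k => gaussianReal 0 1).map fun z => ∑ i, z i ^ 2

instance (k : ℕ) : IsProbabilityMeasure (chiSquare k) :=
  Measure.isProbabilityMeasure_map
    (show Measurable fun z : Fin k → ℝ => ∑ i, z i ^ 2 by fun_prop).aemeasurable

end Deconvolution

end

/-! With the true efficient scores in place of the estimates, the normalized sum is asymptotically
N(0, I*) by the central limit theorem. Replacing them by estimates costs only terms tending to zero
in probability (Slutsky), and `zᵀ (I*)⁻¹ z` is chi-square when z is N(0, I*). This needs I* to be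
positive definite and the efficient score to be centred.

Positive definiteness: a combination `v ⬝ᵥ l*` of the efficient score is a combination of the full
score, with nonzero coefficients if `v ≠ 0`, and the Fisher information, a nonsingular matrix of
second moments, is positive definite.

Centring (`integral_deriv_density_eq_zero`) is the delicate point, since no integrable bound on the
derivative of g is assumed. Along a path q_s of densities, `|q'| ≤ (q'² / q + q) / 2`, and the
integral of this bound is continuous in s because the information is. Dominated convergence with
varying bounds makes `∫ q'` continuous in s; by Fubini its integral over any interval of s is a
difference of total masses, hence 0, so `∫ q'` vanishes. -/

/-! ### Multivariate central limit theorem. -/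

section CentralLimit

open scoped RealInnerProductSpace

variable {Ω : Type*} {mΩ : MeasurableSpace Ω} {P : Measure Ω}

/-- Convergence in distribution depends only on the law of the limit. -/
lemma MeasureTheory.TendstoInDistribution.of_map_eq [IsProbabilityMeasure P] {ι E Ω₁ Ω₂ : Type*} [TopologicalSpace E]
    [MeasurableSpace E] [OpensMeasurableSpace E] {l : Filter ι} {X : ι → Ω → E}
    {m₁ : MeasurableSpace Ω₁} {m₂ : MeasurableSpace Ω₂} {μ₁ : Measure Ω₁} {μ₂ : Measure Ω₂}
    [IsProbabilityMeasure μ₁] [IsProbabilityMeasure μ₂] {Z₁ : Ω₁ → E} {Z₂ : Ω₂ → E}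
    (h : TendstoInDistribution X l Z₁ (fun _ => P) μ₁) (hZ₂ : AEMeasurable Z₂ μ₂)
    (hZ : μ₁.map Z₁ = μ₂.map Z₂) : TendstoInDistribution X l Z₂ (fun _ => P) μ₂ where
  forall_aemeasurable := h.forall_aemeasurable
  aemeasurable_limit := hZ₂
  tendsto := by
    have := h.tendsto
    simp only [hZ] at this
    exact this

/-- The characteristic function at `t` is the one of the marginal in direction `t` at `1`. -/
lemma MeasureTheory.charFun_map_inner_one {E : Type*} [NormedAddCommGroup E]
    [InnerProductSpace ℝ E] [MeasurableSpace E] [BorelSpace E] [SecondCountableTopology E]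
    {X : Ω → E} (hX : AEMeasurable X P) (t : E) :
    charFun (P.map X) t = charFun (P.map fun ω => ⟪t, X ω⟫) 1 := by
  rw [charFun_apply, charFun_apply_real, integral_map hX (by fun_prop),
    integral_map (by fun_prop) (by fun_prop)]
  simp [real_inner_comm]

/-- The multivariate central limit theorem. -/
theorem ProbabilityTheory.tendstoInDistribution_multivariateGaussian
    [IsProbabilityMeasure P] {ι : Type*} [Fintype ι] [DecidableEq ι] {S : Matrix ι ι ℝ} (hS : S.PosSemidef)
    {X : ℕ → Ω → EuclideanSpace ℝ ι} (hX : MemLp (X 0) 2 P) (hindep : iIndepFun X P)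
    (hident : ∀ i, IdentDistrib (X i) (X 0) P P)
    (hmean : ∀ t, ∫ ω, ⟪t, X 0 ω⟫ ∂P = 0)
    (hcov : ∀ t : EuclideanSpace ℝ ι, ∫ ω, ⟪t, X 0 ω⟫ ^ 2 ∂P = t.ofLp ⬝ᵥ S.mulVec t.ofLp) :
    TendstoInDistribution (fun (n : ℕ) ω => (√n)⁻¹ • ∑ i ∈ Finset.range n, X i ω) atTop id
      (fun _ => P) (multivariateGaussian 0 S) := by
  have hXm i : AEMeasurable (X i) P := (hident i).aemeasurable_fst
  have hTm (n : ℕ) : AEMeasurable (fun ω => (√n)⁻¹ • ∑ i ∈ Finset.range n, X i ω) P := by fun_prop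
  refine ⟨hTm, aemeasurable_id, ProbabilityMeasure.tendsto_iff_tendsto_charFun.2 fun t => ?_⟩
  have hinner : Measurable fun x : EuclideanSpace ℝ ι => ⟪t, x⟫ := by fun_prop
  have hvar : Var[fun ω => ⟪t, X 0 ω⟫; P] = t.ofLp ⬝ᵥ S.mulVec t.ofLp := by
    rw [variance_eq_integral (by fun_prop), hmean, ← hcov]
    simp
  -- Cramér–Wold: the scalar theorem is applied in the direction `t`, and its characteristic
  -- functions are evaluated at 1.
  have hlim := (tendstoInDistribution_inv_sqrt_mul_sum_sub (P := P)
    (X := fun i ω => ⟪t, X i ω⟫) (Y := id) HasLaw.id (hX.const_inner t)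
    (hindep.comp (fun _ x => ⟪t, x⟫) fun _ => hinner)
    fun i => (hident i).comp hinner).tendsto
  have hlim := ProbabilityMeasure.tendsto_iff_tendsto_charFun.1 hlim 1
  simp only [ProbabilityMeasure.coe_mk, Measure.map_id, charFun_gaussianReal, hvar] at hlim ⊢
  rw [charFun_multivariateGaussian hS]
  convert hlim using 2
  · rename_i n
    rw [charFun_map_inner_one (hTm n)]
    congr 3
    ext ω
    simp [inner_smul_right, inner_sum, hmean]
  · have : 0 ≤ t.ofLp ⬝ᵥ S.mulVec t.ofLp := by
      simpa using hS.dotProduct_mulVec_nonneg t.ofLp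
    simp [Real.coe_toNNReal _ this]

end CentralLimit

/-! ### Quadratic forms of Gaussian vectors. -/

section ChiSquare

open scoped MatrixOrder

/-- The standardized squared length of a Gaussian vector has a chi-square law. -/
lemma ProbabilityTheory.map_quadratic_multivariateGaussian {k : ℕ} {S : Matrix (Fin k) (Fin k) ℝ}
    (hS : S.PosDef) :
    (multivariateGaussian 0 S).map (fun z => z.ofLp ⬝ᵥ S⁻¹.mulVec z.ofLp) =
      Deconvolution.chiSquare k := by
  rw [multivariateGaussian, ← map_pi_eq_stdGaussian, Measure.map_map (by fun_prop) (by fun_prop),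
    Measure.map_map (by fun_prop) (by fun_prop), Deconvolution.chiSquare]
  congr 1
  ext z
  -- The Gaussian vector is `R z` with z standard, so the claim is the matrix identity `R S⁻¹ R =
  -- 1`.
  set R := CFC.sqrt S
  have hRR : R * R = S := CFC.sqrt_mul_sqrt_self _ hS.posSemidef.nonneg
  have hRt : R.transpose = R := by
    have : IsSelfAdjoint R := (CFC.sqrt_nonneg S).isSelfAdjoint
    simpa [IsSelfAdjoint, Matrix.star_eq_conjTranspose] using this
  have hdet : IsUnit R.det := by
    have := hS.isUnit
    rw [Matrix.isUnit_iff_isUnit_det, ← hRR, Matrix.det_mul] at this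
    exact isUnit_of_mul_isUnit_left this
  have hinv : R * (S⁻¹ * R) = 1 := by
    rw [← hRR, Matrix.mul_inv_rev, Matrix.mul_assoc, Matrix.nonsing_inv_mul _ hdet,
      Matrix.mul_one, Matrix.mul_nonsing_inv _ hdet]
  have : (R.mulVec z) ⬝ᵥ S⁻¹.mulVec (R.mulVec z) = z ⬝ᵥ z := by
    have hz : R.mulVec z = Matrix.vecMul z R := by
      rw [← Matrix.mulVec_transpose, hRt]
    rw [Matrix.mulVec_mulVec]
    conv_lhs => rw [hz, ← Matrix.dotProduct_mulVec, Matrix.mulVec_mulVec, hinv, Matrix.one_mulVec]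
  simpa [dotProduct, pow_two] using this

end ChiSquare

/-! ### Limit law of the score statistic for a general centred score. -/

namespace Deconvolution

open scoped RealInnerProductSpace

/-- If the estimated scores and the estimated inverse covariance are consistent, the quadratic
score statistic is asymptotically chi-square. -/
theorem tendstoInDistribution_effScoreStatistic {k : ℕ} {G : Measure ℝ} [IsProbabilityMeasure G]
    {ψ : ℝ → EuclideanSpace ℝ (Fin k)} {S : Matrix (Fin k) (Fin k) ℝ} (hS : S.PosDef)
    (hψ : MemLp ψ 2 G) (hmean : ∀ t, ∫ y, ⟪t, ψ y⟫ ∂G = 0)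
    (hcov : ∀ t : EuclideanSpace ℝ (Fin k), ∫ y, ⟪t, ψ y⟫ ^ 2 ∂G = t.ofLp ⬝ᵥ S.mulVec t.ofLp)
    {lhat : (n : ℕ) → (Fin n → ℝ) → Fin n → EuclideanSpace ℝ (Fin k)}
    (lhat_meas : ∀ n j, Measurable fun y => lhat n y j)
    {Lhat : (n : ℕ) → (Fin n → ℝ) → Matrix (Fin k) (Fin k) ℝ}
    (Lhat_meas : ∀ n a b, Measurable fun y => Lhat n y a b)
    (hl : ∀ ε : ℝ, 0 < ε → Tendsto (fun n : ℕ => Measure.pi (fun _ : Fin n => G)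
      {y | ε ≤ (1 / √(n : ℝ)) * ‖∑ j, (lhat n y j - ψ (y j))‖}) atTop (𝓝 0))
    (hL : ∀ ε : ℝ, 0 < ε → Tendsto (fun n : ℕ => Measure.pi (fun _ : Fin n => G)
      {y | ε ≤ √(∑ a, ∑ b, (Lhat n y a b - S⁻¹ a b) ^ 2)}) atTop (𝓝 0))
    {Ω : Type*} [MeasurableSpace Ω] {P : Measure Ω} [IsProbabilityMeasure P]
    {Y : ℕ → Ω → ℝ} (hY : ∀ i, HasLaw (Y i) G P) (hindep : iIndepFun Y P) :
    TendstoInDistribution (fun n ω => effScoreStatistic lhat Lhat n fun j : Fin n => Y j ω)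
      atTop (id : ℝ → ℝ) (fun _ => P) (chiSquare k) := by
  -- `ψ` is only a.e. measurable; a Borel version is needed to transfer independence to the scores.
  set ψ' := hψ.1.mk ψ with hψ'_def
  have hψ'm : Measurable ψ' := hψ.1.stronglyMeasurable_mk.measurable
  have hψψ' : ψ =ᵐ[G] ψ' := hψ.1.ae_eq_mk
  have hYm i : AEMeasurable (Y i) P := (hY i).aemeasurable
  have hlaw (n : ℕ) : HasLaw (fun ω (j : Fin n) => Y j ω) (Measure.pi fun _ => G) P :=
    (hindep.precomp Fin.val_injective).hasLaw_pi fun j => hY j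
  -- Only an inequality, because the sets in `hl` need not be measurable; it is enough for limits
  -- equal to zero.
  have hpre (n : ℕ) (A : Set (Fin n → ℝ)) :
      P ((fun ω (j : Fin n) => Y j ω) ⁻¹' A) ≤ Measure.pi (fun _ => G) A := by
    rw [← (hlaw n).map_eq]
    exact Measure.le_map_apply (hlaw n).aemeasurable A
  have hX i : HasLaw (fun ω => ψ' (Y i ω)) (G.map ψ') P :=
    HasLaw.fun_comp ⟨hψ'm.aemeasurable, rfl⟩ (hY i)
  have hint {f : EuclideanSpace ℝ (Fin k) → ℝ} (hf : Measurable f) :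
      ∫ ω, f (ψ' (Y 0 ω)) ∂P = ∫ y, f (ψ y) ∂G := by
    rw [← (hY 0).integral_comp (f := fun y => f (ψ y))]
    · refine integral_congr_ae ?_
      have : ∀ᵐ ω ∂P, ψ (Y 0 ω) = ψ' (Y 0 ω) :=
        ae_of_ae_map (hYm 0) (by rw [(hY 0).map_eq]; exact hψψ')
      filter_upwards [this] with ω hω
      simp [hω]
    · exact (hf.comp_aemeasurable hψ.1.aemeasurable).aestronglyMeasurable
  -- the central limit theorem for the true scores
  have hT := tendstoInDistribution_multivariateGaussian hS.posSemidef
    (X := fun i ω => ψ' (Y i ω)) (P := P)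
    (by
      have h : MemLp ψ' 2 (P.map (Y 0)) := by
        rw [(hY 0).map_eq]; exact (memLp_congr_ae hψψ').1 hψ
      exact h.comp_of_map (hYm 0))
    (hindep.comp (fun _ => ψ') fun _ => hψ'm)
    (fun i => ⟨(hX i).aemeasurable, (hX 0).aemeasurable,
      (hX i).map_eq.trans (hX 0).map_eq.symm⟩)
    (fun t => by rw [hint (f := fun x => ⟪t, x⟫) (by fun_prop), hmean])
    (fun t => by rw [hint (f := fun x => ⟪t, x⟫ ^ 2) (by fun_prop), hcov])
  -- the estimated scores
  have hUm (n : ℕ) : AEMeasurable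
      (fun ω => (1 / √(n : ℝ)) • ∑ j, lhat n (fun i : Fin n => Y i ω) j) P := by
    have h1 : Measurable fun y : Fin n → ℝ => (1 / √(n : ℝ)) • ∑ j, lhat n y j := by
      have := lhat_meas n
      fun_prop
    exact h1.comp_aemeasurable (hlaw n).aemeasurable
  have hU := tendstoInDistribution_of_tendstoInMeasure_sub
    (fun (n : ℕ) ω => (1 / √(n : ℝ)) • ∑ j, lhat n (fun i : Fin n => Y i ω) j) id hT
    (by
      rw [tendstoInMeasure_iff_norm]
      intro ε hε
      refine tendsto_of_tendsto_of_tendsto_of_le_of_le tendsto_const_nhds (hl ε hε)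
        (fun _ => zero_le) fun n => ?_
      refine le_trans (measure_mono_ae ?_) (hpre n _)
      have hae : ∀ᵐ ω ∂P, ∀ i, ψ (Y i ω) = ψ' (Y i ω) :=
        ae_all_iff.2 fun i => ae_of_ae_map (hYm i) (by rw [(hY i).map_eq]; exact hψψ')
      filter_upwards [hae] with ω hω h
      refine le_trans (show ε ≤ _ from h) (le_of_eq ?_)
      simp only [Pi.sub_apply, Pi.zero_apply, sub_zero, Finset.sum_range, ← one_div,
        ← smul_sub, ← Finset.sum_sub_distrib, norm_smul, hω]
      simp)
    hUm
  -- the estimated inverse information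
  have hWm (n : ℕ) : AEMeasurable (fun ω => WithLp.toLp 2 fun p : Fin k × Fin k =>
      Lhat n (fun i : Fin n => Y i ω) p.1 p.2) P := by
    have h1 : Measurable fun y : Fin n → ℝ =>
        WithLp.toLp 2 fun p : Fin k × Fin k => Lhat n y p.1 p.2 := by
      have := Lhat_meas n
      fun_prop
    exact h1.comp_aemeasurable (hlaw n).aemeasurable
  have hW : TendstoInMeasure P (fun (n : ℕ) ω => WithLp.toLp 2 fun p : Fin k × Fin k =>
      Lhat n (fun i : Fin n => Y i ω) p.1 p.2) atTop
      fun _ => WithLp.toLp 2 fun p : Fin k × Fin k => S⁻¹ p.1 p.2 := by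
    rw [tendstoInMeasure_iff_norm]
    intro ε hε
    refine tendsto_of_tendsto_of_tendsto_of_le_of_le tendsto_const_nhds (hL ε hε)
      (fun _ => zero_le) fun n => ?_
    refine le_trans (measure_mono fun ω h => ?_) (hpre n _)
    refine le_trans (show ε ≤ _ from h) (le_of_eq ?_)
    simp [EuclideanSpace.norm_eq, Fintype.sum_prod_type]
  -- the continuous mapping theorem
  have hg : Continuous fun p : EuclideanSpace ℝ (Fin k) × EuclideanSpace ℝ (Fin k × Fin k) =>
      p.1.ofLp ⬝ᵥ (Matrix.of fun a b => p.2.ofLp (a, b)).mulVec p.1.ofLp := by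
    simp only [dotProduct, Matrix.mulVec, Matrix.of_apply]
    fun_prop
  have hlim := TendstoInDistribution.continuous_comp_prodMk_of_tendstoInMeasure_const
    hg hU hW hWm
  refine hlim.of_map_eq aemeasurable_id ?_
  rw [Measure.map_id, ← map_quadratic_multivariateGaussian hS]
  rfl

end Deconvolution

/-! ### Mean zero of the score in a one-parameter family. -/

section ParametricDensity

variable {Y : Type*} {mY : MeasurableSpace Y} {μ : Measure Y}

/-- A dominated convergence theorem with varying bounds whose integrals converge, where the bounds
need not converge from above. -/
theorem MeasureTheory.tendsto_integral_of_tendsto_integral_bound {ι : Type*} {l : Filter ι}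
    [l.IsCountablyGenerated] {a D : ι → Y → ℝ} {a₀ D₀ : Y → ℝ}
    (ha : ∀ i, AEStronglyMeasurable (a i) μ) (hD : ∀ i, Integrable (D i) μ)
    (hD₀ : Integrable D₀ μ) (haD : ∀ i y, |a i y| ≤ D i y) (haD₀ : ∀ y, |a₀ y| ≤ D₀ y)
    (hlim : ∀ y, Tendsto (fun i => a i y) l (𝓝 (a₀ y)))
    (hmin : ∀ y, Tendsto (fun i => min (D i y) (D₀ y)) l (𝓝 (D₀ y)))
    (hint : Tendsto (fun i => ∫ y, D i y ∂μ) l (𝓝 (∫ y, D₀ y ∂μ))) :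
    Tendsto (fun i => ∫ y, a i y ∂μ) l (𝓝 (∫ y, a₀ y ∂μ)) := by
  have hD0 i y : 0 ≤ D i y := (abs_nonneg _).trans (haD i y)
  have hD₀0 y : 0 ≤ D₀ y := (abs_nonneg _).trans (haD₀ y)
  -- Clamping `a i` to `[-m i, m i]` gives `c i`, dominated by the fixed `D₀`. The error is at most
  -- `D i - m i`, whose integral tends to zero.
  set m : ι → Y → ℝ := fun i y => min (D i y) (D₀ y)
  set c : ι → Y → ℝ := fun i y => max (-m i y) (min (a i y) (m i y))
  have hm0 i y : 0 ≤ m i y := le_min (hD0 i y) (hD₀0 y)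
  have hmD i y : m i y ≤ D i y := min_le_left _ _
  have hmD₀ i y : m i y ≤ D₀ y := min_le_right _ _
  have hmm i : AEStronglyMeasurable (m i) μ := (hD i).1.inf hD₀.1
  have hcm i : AEStronglyMeasurable (c i) μ := (hmm i).neg.sup ((ha i).inf (hmm i))
  have hcabs i y : |c i y| ≤ m i y := by
    rw [abs_le]
    exact ⟨le_max_left _ _, max_le (by linarith [hm0 i y]) (min_le_right _ _)⟩
  have hac i y : |a i y - c i y| ≤ D i y - m i y := by
    have h1 := abs_le.1 (haD i y)
    have h2 := hm0 i y
    have h3 := hmD i y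
    simp only [c]
    rcases max_cases (-m i y) (min (a i y) (m i y)) with h | h <;>
    rcases min_cases (a i y) (m i y) with h' | h' <;> rw [abs_le] <;> constructor <;> linarith
  have hmi i : Integrable (m i) μ := hD₀.mono' (hmm i) <| ae_of_all _ fun y => by
    rw [Real.norm_eq_abs, abs_of_nonneg (hm0 i y)]; exact hmD₀ i y
  have hci i : Integrable (c i) μ := (hmi i).mono' (hcm i) <| ae_of_all _ fun y => hcabs i y
  have hai i : Integrable (a i) μ := (hD i).mono' (ha i) <| ae_of_all _ fun y => haD i y
  have hclim : Tendsto (fun i => ∫ y, c i y ∂μ) l (𝓝 (∫ y, a₀ y ∂μ)) := by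
    refine tendsto_integral_filter_of_dominated_convergence D₀ (.of_forall hcm)
      (.of_forall fun i => ae_of_all _ fun y => (hcabs i y).trans (hmD₀ i y)) hD₀
      (ae_of_all _ fun y => ?_)
    have h := abs_le.1 (haD₀ y)
    have : Tendsto (fun i => c i y) l (𝓝 (max (-D₀ y) (min (a₀ y) (D₀ y)))) :=
      (hmin y).neg.max ((hlim y).min (hmin y))
    rwa [min_eq_left h.2, max_eq_right h.1] at this
  have hmlim : Tendsto (fun i => ∫ y, m i y ∂μ) l (𝓝 (∫ y, D₀ y ∂μ)) :=
    tendsto_integral_filter_of_dominated_convergence D₀ (.of_forall hmm)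
      (.of_forall fun i => ae_of_all _ fun y => by
        rw [Real.norm_eq_abs, abs_of_nonneg (hm0 i y)]; exact hmD₀ i y) hD₀
      (ae_of_all _ hmin)
  have hdiff : Tendsto (fun i => ∫ y, a i y ∂μ - ∫ y, c i y ∂μ) l (𝓝 0) := by
    refine squeeze_zero_norm (a := fun i => ∫ y, D i y ∂μ - ∫ y, m i y ∂μ) (fun i => ?_)
      (by simpa using hint.sub hmlim)
    rw [← integral_sub (hai i) (hci i), ← integral_sub (hD i) (hmi i)]
    exact norm_integral_le_of_norm_le ((hD i).sub (hmi i)) (ae_of_all _ fun y => hac i y)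
  simpa using hdiff.add hclim

/-- In a one-parameter family of probability densities which is continuously differentiable in the
parameter and whose Fisher information is finite and continuous, the score has mean zero. -/
theorem MeasureTheory.integral_deriv_density_eq_zero [SFinite μ] {q q' : ℝ → Y → ℝ}
    (hq : ∀ y s, HasDerivAt (fun s => q s y) (q' s y) s)
    (hq' : ∀ y, Continuous fun s => q' s y)
    (hqm : ∀ s, Measurable (q s)) (hq0 : ∀ s y, 0 ≤ q s y)
    (hqi : ∀ s, Integrable (q s) μ) (hq1 : ∀ s, ∫ y, q s y ∂μ = 1)
    (hJi : ∀ s, Integrable (fun y => q' s y ^ 2 / q s y) μ)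
    (hJ : Continuous fun s => ∫ y, q' s y ^ 2 / q s y ∂μ) (s : ℝ) :
    ∫ y, q' s y ∂μ = 0 := by
  -- A zero of the nonnegative `q` is a minimum in the parameter, so the convention `x / 0 = 0`
  -- loses nothing in `q'² / q`.
  have hzero s y (h : q s y = 0) : q' s y = 0 :=
    IsLocalMin.hasDerivAt_eq_zero (f := fun s => q s y)
      (.of_forall fun t => by simpa [h] using hq0 t y) (hq y s)
  have hq'm s : Measurable (q' s) := by
    have hu : Tendsto (fun n : ℕ => (1 : ℝ) / (n + 1)) atTop (𝓝[≠] 0) := by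
      refine tendsto_nhdsWithin_iff.2 ⟨tendsto_one_div_add_atTop_nhds_zero_nat,
        .of_forall fun n => ?_⟩
      have : (0 : ℝ) < 1 / (n + 1) := by positivity
      exact this.ne'
    refine measurable_of_tendsto_metrizable
      (f := fun (n : ℕ) y => ((1 : ℝ) / (n + 1))⁻¹ • (q (s + 1 / (n + 1)) y - q s y))
      (fun n => ((hqm _).sub (hqm _)).const_mul _) ?_
    exact tendsto_pi_nhds.2 fun y => (hq y s).tendsto_slope_zero.comp hu
  have hq'mm : Measurable (Function.uncurry q') :=
    measurable_uncurry_of_continuous_of_measurable hq' hq'm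
  set D : ℝ → Y → ℝ := fun s y => (q' s y ^ 2 / q s y + q s y) / 2
  have hDi s : Integrable (D s) μ := ((hJi s).add (hqi s)).div_const 2
  have hDint s : ∫ y, D s y ∂μ = (∫ y, q' s y ^ 2 / q s y ∂μ + 1) / 2 := by
    simp only [D]
    rw [integral_div, integral_add (hJi s) (hqi s), hq1]
  have hDc : Continuous fun s => ∫ y, D s y ∂μ := by
    simp only [hDint]
    fun_prop
  have hle s y : |q' s y| ≤ D s y := by
    rcases (hq0 s y).eq_or_lt with h | h
    · simp [D, ← h, hzero s y h.symm]
    · simp only [D]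
      have : q' s y ^ 2 / q s y + q s y - 2 * |q' s y| = (|q' s y| - q s y) ^ 2 / q s y := by
        rw [← sq_abs (q' s y)]
        field_simp
        ring
      have : 0 ≤ (|q' s y| - q s y) ^ 2 / q s y := by positivity
      linarith
  have hmc : Continuous fun s => ∫ y, q' s y ∂μ := by
    refine continuous_iff_continuousAt.2 fun s₀ =>
      tendsto_integral_of_tendsto_integral_bound (D := D) (D₀ := D s₀)
        (fun s => (hq'm s).aestronglyMeasurable) hDi (hDi s₀) hle (hle s₀)
        (fun y => (hq' y).tendsto s₀) (fun y => ?_) (hDc.tendsto s₀)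
    -- Where `q s₀ y = 0`, `D s y` may fail to converge to `D s₀ y = 0`, but its minimum with 0 is
    -- identically 0. This is why only the minimum is required to converge.
    rcases (hq0 s₀ y).eq_or_lt with h | h
    · have h0 : D s₀ y = 0 := by simp [D, ← h]
      simp only [h0]
      refine tendsto_const_nhds.congr fun s => ?_
      rw [min_eq_right ((abs_nonneg _).trans (hle s y))]
    · have : ContinuousAt (fun s => D s y) s₀ :=
        (((((hq' y).continuousAt (x := s₀)).pow 2).div (hq y s₀).continuousAt h.ne').add
          (hq y s₀).continuousAt).div_const 2
      simpa using Tendsto.min this (tendsto_const_nhds (x := D s₀ y))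
  have hint (t : ℝ) : ∫ r in s..t, ∫ y, q' r y ∂μ = 0 := by
    have hprod : Integrable (Function.uncurry q')
        ((volume.restrict (Set.uIoc s t)).prod μ) := by
      refine (integrable_prod_iff hq'mm.aestronglyMeasurable).2
        ⟨ae_of_all _ fun r => (hDi r).mono' (hq'm r).aestronglyMeasurable
          (ae_of_all _ fun y => hle r y), ?_⟩
      refine Integrable.mono' (g := fun r => ∫ y, D r y ∂μ) ?_
        hq'mm.aestronglyMeasurable.norm.integral_prod_right' (ae_of_all _ fun r => ?_)
      · exact (hDc.integrableOn_uIcc (a := s) (b := t)).mono_set Set.uIoc_subset_uIcc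
      · rw [Real.norm_eq_abs, abs_of_nonneg (integral_nonneg fun _ => norm_nonneg _)]
        exact integral_mono_of_nonneg (ae_of_all _ fun _ => norm_nonneg _) (hDi r)
          (ae_of_all _ fun y => hle r y)
    rw [intervalIntegral_integral_swap hprod]
    have hftc y : ∫ r in s..t, q' r y = q t y - q s y :=
      intervalIntegral.integral_eq_sub_of_hasDerivAt (fun r _ => hq y r)
        ((hq' y).intervalIntegrable _ _)
    simp only [hftc]
    rw [integral_sub (hqi t) (hqi s), hq1, hq1, sub_self]
  -- The integral vanishes for every upper endpoint, so its derivative there, which is the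
  -- continuous integrand, vanishes too.
  have := hmc.deriv_integral _ s s
  simpa [hint] using this.symm

end ParametricDensity

/-! ### Densities and scores of the convolution model. -/

namespace Deconvolution

lemma IsDensity.isProbabilityMeasure {p : ℝ → ℝ} (hp : IsDensity p) :
    IsProbabilityMeasure (densityMeasure p) := by
  refine ⟨?_⟩
  rw [densityMeasure, withDensity_apply _ .univ, Measure.restrict_univ,
    ← ofReal_integral_eq_lintegral_ofReal hp.integrable (ae_of_all _ hp.nonneg),
    hp.integral_eq_one, ENNReal.ofReal_one]

lemma IsDensity.of_isProbabilityMeasure {p : ℝ → ℝ} (hm : Measurable p) (h0 : ∀ x, 0 ≤ p x)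
    (h : IsProbabilityMeasure (densityMeasure p)) : IsDensity p := by
  have h1 : ∫⁻ x, ENNReal.ofReal (p x) = 1 := by
    simpa [densityMeasure] using h.measure_univ
  have hi : Integrable p := by
    refine ⟨hm.aestronglyMeasurable, ?_⟩
    rw [hasFiniteIntegral_iff_ofReal (ae_of_all _ h0), h1]
    exact ENNReal.one_lt_top
  refine ⟨hm, h0, hi, ?_⟩
  rw [integral_eq_lintegral_of_nonneg_ae (ae_of_all _ h0) hm.aestronglyMeasurable, h1,
    ENNReal.toReal_one]

lemma integral_densityMeasure {p : ℝ → ℝ} (hp : IsDensity p) (F : ℝ → ℝ) :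
    ∫ y, F y ∂(densityMeasure p) = ∫ y, p y * F y := by
  rw [densityMeasure, integral_withDensity_eq_integral_toReal_smul
    hp.measurable.ennreal_ofReal (ae_of_all _ fun _ => ENNReal.ofReal_lt_top)]
  simp [ENNReal.toReal_ofReal (hp.nonneg _)]

lemma integrable_densityMeasure {p : ℝ → ℝ} (hp : IsDensity p) (F : ℝ → ℝ) :
    Integrable F (densityMeasure p) ↔ Integrable fun y => p y * F y := by
  rw [densityMeasure, integrable_withDensity_iff_integrable_smul'
    hp.measurable.ennreal_ofReal (ae_of_all _ fun _ => ENNReal.ofReal_lt_top)]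
  simp [ENNReal.toReal_ofReal (hp.nonneg _)]

namespace Model

variable {k m : ℕ} (M : Model k m) {θ : EuclideanSpace ℝ (Fin k)} {η : EuclideanSpace ℝ (Fin m)}

lemma g_nonneg (hθ : θ ∈ M.Θ) (hη : η ∈ M.Λ) (y : ℝ) : 0 ≤ M.g θ η y :=
  integral_nonneg fun s => mul_nonneg ((M.isDensity_f θ hθ).nonneg s)
    ((M.isDensity_h η hη).nonneg _)

lemma measurable_g (hθ : θ ∈ M.Θ) (hη : η ∈ M.Λ) : Measurable (M.g θ η) := by
  have hf := (M.isDensity_f θ hθ).measurable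
  have hh := (M.isDensity_h η hη).measurable
  have : Measurable fun p : ℝ × ℝ => M.f θ p.2 * M.h η (p.1 - p.2) := by fun_prop
  exact this.stronglyMeasurable.integral_prod_right'.measurable

/-- The law of an observation is the convolution of the laws of the signal and the noise. -/
lemma conv_eq_G (hθ : θ ∈ M.Θ) (hη : η ∈ M.Λ) :
    densityMeasure (M.f θ) ∗ densityMeasure (M.h η) = M.G θ η := by
  have hf := M.isDensity_f θ hθ
  have hh := M.isDensity_h η hη
  rw [densityMeasure, densityMeasure, conv_withDensity_eq_lconvolution
    hf.measurable.ennreal_ofReal hh.measurable.ennreal_ofReal, G, densityMeasure]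
  refine withDensity_congr_ae ?_
  -- The integral defining g converges for almost every y only; elsewhere it takes the default value
  -- 0, on a null set.
  have hconv := hf.integrable.ae_convolution_exists (ContinuousLinearMap.mul ℝ ℝ) hh.integrable
  filter_upwards [hconv] with y hy
  have hy : Integrable fun s => M.f θ s * M.h η (y - s) := hy
  rw [g, ofReal_integral_eq_lintegral_ofReal hy
    (ae_of_all _ fun s => mul_nonneg (hf.nonneg s) (hh.nonneg _)), lconvolution_def]
  refine lintegral_congr fun s => ?_
  rw [ENNReal.ofReal_mul (hf.nonneg s), neg_add_eq_sub]

lemma isProbabilityMeasure_G (hθ : θ ∈ M.Θ) (hη : η ∈ M.Λ) : IsProbabilityMeasure (M.G θ η) := by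
  have := (M.isDensity_f θ hθ).isProbabilityMeasure
  have := (M.isDensity_h η hη).isProbabilityMeasure
  rw [← M.conv_eq_G hθ hη]
  infer_instance

/-- Integrability and unit mass come from `conv_eq_G`, as a convolution of probability measures is a
probability measure. -/
lemma isDensity_g (hθ : θ ∈ M.Θ) (hη : η ∈ M.Λ) : IsDensity (M.g θ η) :=
  .of_isProbabilityMeasure (M.measurable_g hθ hη) (M.g_nonneg hθ hη)
    (M.isProbabilityMeasure_G hθ hη)

/-- The coordinate directions of the full parameter space. -/
noncomputable def coordDir : Fin k ⊕ Fin m → EuclideanSpace ℝ (Fin k) × EuclideanSpace ℝ (Fin m) :=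
  Sum.elim (fun a => (EuclideanSpace.single a 1, 0)) (fun b => (0, EuclideanSpace.single b 1))

lemma gradient_apply {ι : Type*} [Fintype ι] [DecidableEq ι] (F : EuclideanSpace ℝ ι → ℝ)
    (x : EuclideanSpace ℝ ι) (a : ι) :
    gradient F x a = fderiv ℝ F x (EuclideanSpace.single a 1) := by
  have := InnerProductSpace.toDual_symm_apply (𝕜 := ℝ) (x := EuclideanSpace.single a (1 : ℝ))
    (y := fderiv ℝ F x)
  rw [← this, gradient, EuclideanSpace.inner_single_right]
  simp

/-- The components of the score are the logarithmic partial derivatives of the density. -/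
lemma g_mul_score (hθ : θ ∈ M.Θ) (hη : η ∈ M.Λ) {y : ℝ}
    (hy : ContDiffOn ℝ 1
      (fun p : EuclideanSpace ℝ (Fin k) × EuclideanSpace ℝ (Fin m) => M.g p.1 p.2 y)
      (M.Θ ×ˢ M.Λ)) (c : Fin k ⊕ Fin m) :
    M.g θ η y * M.score θ η y c = fderiv ℝ
      (fun p : EuclideanSpace ℝ (Fin k) × EuclideanSpace ℝ (Fin m) => M.g p.1 p.2 y)
      (θ, η) (coordDir c) := by
  have hU : M.Θ ×ˢ M.Λ ∈ 𝓝 (θ, η) := (M.isOpen_Θ.prod M.isOpen_Λ).mem_nhds ⟨hθ, hη⟩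
  have hd := ((hy.contDiffAt hU).differentiableAt one_ne_zero).hasFDerivAt
  -- At a zero of g the truncated score contributes 0, and so does the derivative, g being minimal
  -- there over the open parameter set.
  rcases (M.g_nonneg hθ hη y).eq_or_lt with h | h
  · rw [← h, zero_mul, IsLocalMin.fderiv_eq_zero]
    · rfl
    · filter_upwards [hU] with p hp
      simpa [← h] using M.g_nonneg hp.1 hp.2 y
  · rcases c with a | b
    · have h1 : HasFDerivAt (fun θ' => M.g θ' η y) _ θ :=
        hd.comp (f := fun θ' => (θ', η)) θ (hasFDerivAt_prodMk_left θ η)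
      simp [score, scoreθ, h, gradient_apply, h1.fderiv, coordDir, h.ne']
    · have h1 : HasFDerivAt (fun η' => M.g θ η' y) _ η :=
        hd.comp (f := fun η' => (θ, η')) η (hasFDerivAt_prodMk_right θ η)
      simp [score, scoreη, h, gradient_apply, h1.fderiv, coordDir, h.ne']

variable {M}

/-- The score has mean zero. -/
theorem IsRegular.integral_score_eq_zero (hM : M.IsRegular) (hθ : θ ∈ M.Θ) (hη : η ∈ M.Λ)
    (c : Fin k ⊕ Fin m) : ∫ y, M.score θ η y c ∂(M.G θ η) = 0 := by
  -- Cutting g off outside this conull set makes the smoothness hold for every y, as the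
  -- one-parameter result requires.
  obtain ⟨A, hA, hAm, hAd⟩ := hM.A1.exists_measurable_mem
  set U := M.Θ ×ˢ M.Λ
  have hUo : IsOpen U := M.isOpen_Θ.prod M.isOpen_Λ
  obtain ⟨r, hr, hrU⟩ : ∃ r > 0, ∀ t : ℝ, |t| < r → (θ, η) + t • coordDir c ∈ U := by
    have : Tendsto (fun t : ℝ => (θ, η) + t • coordDir c) (𝓝 0) (𝓝 (θ, η)) := by
      have : Continuous fun t : ℝ => (θ, η) + t • coordDir c := by fun_prop
      simpa using this.tendsto 0
    obtain ⟨r, hr, h⟩ := Metric.eventually_nhds_iff.1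
      (this.eventually (hUo.mem_nhds ⟨hθ, hη⟩))
    exact ⟨r, hr, fun t ht => h (by simpa [Real.dist_eq] using ht)⟩
  -- The displacement `δ * sin s` stays below `r` for all real s, and its speed at 0 is `δ ≠ 0`,
  -- which is divided out at the end.
  set δ := r / 2
  have hδ : 0 < δ := half_pos hr
  -- a smooth path in the parameter space, defined on the whole line
  set p : ℝ → EuclideanSpace ℝ (Fin k) × EuclideanSpace ℝ (Fin m) :=
    fun s => (θ, η) + (δ * Real.sin s) • coordDir c with hp_def
  have hpU s : p s ∈ U := by
    refine hrU _ ?_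
    rw [abs_mul, abs_of_pos hδ]
    have := mul_le_mul_of_nonneg_left (Real.abs_sin_le_one s) hδ.le
    have : δ < r := half_lt_self hr
    linarith
  have hp0 : p 0 = (θ, η) := by simp [p]
  have hpc : ContDiff ℝ 1 p := by fun_prop
  have hpd s : HasDerivAt p ((δ * Real.cos s) • coordDir c) s :=
    (((Real.hasDerivAt_sin s).const_mul δ).smul_const _).const_add _
  set gy : ℝ → EuclideanSpace ℝ (Fin k) × EuclideanSpace ℝ (Fin m) → ℝ :=
    fun y p => M.g p.1 p.2 y
  set q : ℝ → ℝ → ℝ := fun s => A.indicator (M.g (p s).1 (p s).2)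
  set q' : ℝ → ℝ → ℝ := fun s => A.indicator fun y =>
    (δ * Real.cos s) * (M.g (p s).1 (p s).2 y * M.score (p s).1 (p s).2 y c)
  have hAe : ∀ᵐ y, y ∈ A := hA
  have hg s : IsDensity (M.g (p s).1 (p s).2) := M.isDensity_g (hpU s).1 (hpU s).2
  have hqg s : q s =ᵐ[volume] M.g (p s).1 (p s).2 := by
    filter_upwards [hAe] with y hy using Set.indicator_of_mem hy _
  have hderiv y (hy : y ∈ A) s : HasDerivAt (fun s => gy y (p s)) (q' s y) s := by
    have hd := (((hAd y hy).contDiffAt (hUo.mem_nhds (hpU s))).differentiableAt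
      one_ne_zero).hasFDerivAt
    have := hd.comp_hasDerivAt s (hpd s)
    simp only [q', Set.indicator_of_mem hy]
    rw [M.g_mul_score (hpU s).1 (hpU s).2 (hAd y hy) c]
    rw [map_smul, smul_eq_mul] at this
    exact this
  -- The information along the path is `(δ cos s)²` times a diagonal entry of the Fisher
  -- information, so A2 and A3 give its finiteness and continuity.
  have hJ s : (fun y => q' s y ^ 2 / q s y) =ᵐ[volume] fun y => (δ * Real.cos s) ^ 2 *
      (M.g (p s).1 (p s).2 y * (M.score (p s).1 (p s).2 y c * M.score (p s).1 (p s).2 y c)) := by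
    filter_upwards [hAe] with y hy
    simp only [q, q', Set.indicator_of_mem hy]
    rcases eq_or_ne (M.g (p s).1 (p s).2 y) 0 with h | h
    · simp [h]
    · field_simp
  have key := integral_deriv_density_eq_zero (μ := volume) (q := q) (q' := q')
    (fun y s => by
      by_cases hy : y ∈ A
      · simpa [q, hy] using hderiv y hy s
      · simpa [q, q', hy] using hasDerivAt_const s (0 : ℝ))
    (fun y => by
      by_cases hy : y ∈ A
      · have hc : ContDiff ℝ 1 fun s => gy y (p s) :=
          contDiff_iff_contDiffAt.2 fun s =>
            ((hAd y hy).contDiffAt (hUo.mem_nhds (hpU s))).comp s hpc.contDiffAt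
        have := hc.continuous_deriv le_rfl
        rwa [show deriv (fun s => gy y (p s)) = fun s => q' s y from
          funext fun s => (hderiv y hy s).deriv] at this
      · simpa [q', hy] using continuous_const)
    (fun s => (hg s).measurable.indicator hAm)
    (fun s y => Set.indicator_nonneg (fun y _ => (hg s).nonneg y) y)
    (fun s => (hg s).integrable.congr (hqg s).symm)
    (fun s => by rw [integral_congr_ae (hqg s), (hg s).integral_eq_one])
    (fun s => by
      rw [integrable_congr (hJ s)]
      refine Integrable.const_mul ?_ _
      rw [← integrable_densityMeasure (hg s)]
      have hc : MemLp (fun y => M.score (p s).1 (p s).2 y c) 2 (M.G (p s).1 (p s).2) :=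
        (EuclideanSpace.proj c : EuclideanSpace ℝ (Fin k ⊕ Fin m) →L[ℝ] ℝ).comp_memLp'
          (hM.A2 _ (hpU s).1 _ (hpU s).2)
      exact hc.integrable_mul hc)
    (by
      have : ∀ s, ∫ y, q' s y ^ 2 / q s y = (δ * Real.cos s) ^ 2 *
          M.fisherInfo (p s).1 (p s).2 c c := fun s => by
        rw [integral_congr_ae (hJ s), integral_const_mul, ← integral_densityMeasure (hg s)]
        rfl
      simp only [this]
      have hI : Continuous fun s => M.fisherInfo (p s).1 (p s).2 :=
        hM.A3_continuous.comp_continuous hpc.continuous hpU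
      have := hI.matrix_elem c c
      fun_prop) 0
  have hq'0 : q' 0 =ᵐ[volume] fun y => δ * (M.g θ η y * M.score θ η y c) := by
    filter_upwards [hAe] with y hy
    simp [q', hy, hp0]
  rw [integral_congr_ae hq'0, integral_const_mul, ← integral_densityMeasure
    (M.isDensity_g hθ hη)] at key
  exact (mul_eq_zero.1 key).resolve_left hδ.ne'

end Model

end Deconvolution

/-! ### Moments of the efficient score. -/

namespace Deconvolution.Model

open scoped RealInnerProductSpace

variable {k m : ℕ} {M : Model k m} {θ : EuclideanSpace ℝ (Fin k)}
  {η : EuclideanSpace ℝ (Fin m)}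

lemma IsRegular.memLp_score_apply (hM : M.IsRegular) (hθ : θ ∈ M.Θ) (hη : η ∈ M.Λ)
    (c : Fin k ⊕ Fin m) : MemLp (fun y => M.score θ η y c) 2 (M.G θ η) :=
  (EuclideanSpace.proj c : EuclideanSpace ℝ (Fin k ⊕ Fin m) →L[ℝ] ℝ).comp_memLp'
    (hM.A2 θ hθ η hη)

/-- A quadratic form of the matrix of second moments of a random vector. -/
lemma integral_dotProduct_sq {ι : Type*} [Fintype ι] {μ : Measure ℝ} {F : ℝ → ι → ℝ}
    (hF : ∀ a, MemLp (fun y => F y a) 2 μ) (u : ι → ℝ) :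
    ∫ y, (u ⬝ᵥ F y) ^ 2 ∂μ =
      u ⬝ᵥ (Matrix.of fun a b => ∫ y, F y a * F y b ∂μ).mulVec u := by
  have hi a b : Integrable (fun y => F y a * F y b) μ := (hF a).integrable_mul (hF b)
  have h1 y : (u ⬝ᵥ F y) ^ 2 = ∑ a, ∑ b, u a * u b * (F y a * F y b) := by
    rw [pow_two, dotProduct, Finset.sum_mul_sum]
    exact Finset.sum_congr rfl fun a _ => Finset.sum_congr rfl fun b _ => by ring
  simp only [h1]
  rw [integral_finsetSum _ fun a _ => integrable_finsetSum _ fun b _ => (hi a b).const_mul _]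
  simp only [dotProduct, Matrix.mulVec, Matrix.of_apply, Finset.mul_sum]
  refine Finset.sum_congr rfl fun a _ => ?_
  rw [integral_finsetSum _ fun b _ => (hi a b).const_mul _]
  refine Finset.sum_congr rfl fun b _ => ?_
  rw [integral_const_mul]
  ring

lemma posSemidef_moment {ι : Type*} [Fintype ι] {μ : Measure ℝ} {F : ℝ → ι → ℝ}
    (hF : ∀ a, MemLp (fun y => F y a) 2 μ) :
    (Matrix.of fun a b => ∫ y, F y a * F y b ∂μ).PosSemidef := by
  refine .of_dotProduct_mulVec_nonneg (by ext a b; simp [mul_comm]) fun u => ?_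
  rw [star_trivial, ← integral_dotProduct_sq hF]
  exact integral_nonneg fun y => sq_nonneg _

/-- The Fisher information is positive definite. -/
lemma IsRegular.posDef_fisherInfo (hM : M.IsRegular) (hθ : θ ∈ M.Θ) (hη : η ∈ M.Λ) :
    (M.fisherInfo θ η).PosDef :=
  (posSemidef_moment (hM.memLp_score_apply hθ hη)).posDef_iff_isUnit.2
    ((Matrix.isUnit_iff_isUnit_det _).2 (hM.A3_nonsingular θ hθ η hη))

variable (M θ η) in
/-- The coefficients of the linear combination of the full score given by a linear combination of
the efficient score. -/
noncomputable def effCoeff (v : Fin k → ℝ) : Fin k ⊕ Fin m → ℝ :=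
  Sum.elim v (-Matrix.vecMul v
    ((M.fisherInfo θ η).toBlocks₁₂ * ((M.fisherInfo θ η).toBlocks₂₂)⁻¹))

/-- Reduces integrability, centring and nondegeneracy of the efficient score to those of the full
score. -/
lemma dotProduct_effScore (v : Fin k → ℝ) (y : ℝ) :
    v ⬝ᵥ (M.effScore θ η y).ofLp = M.effCoeff θ η v ⬝ᵥ (M.score θ η y).ofLp := by
  simp only [effScore, effCoeff, score, WithLp.ofLp_sub, dotProduct_sub, Matrix.dotProduct_mulVec,
    sumElim_dotProduct_sumElim, neg_dotProduct]
  ring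

lemma IsRegular.memLp_effScore (hM : M.IsRegular) (hθ : θ ∈ M.Θ) (hη : η ∈ M.Λ) :
    MemLp (M.effScore θ η) 2 (M.G θ η) := by
  refine MemLp.of_eval_piLp fun a => ?_
  have h y : M.effScore θ η y a =
      ∑ c, M.effCoeff θ η (Pi.single a 1) c * M.score θ η y c := by
    rw [← dotProduct, ← dotProduct_effScore]
    simp
  simp only [h]
  exact memLp_finsetSum _ fun c _ => (hM.memLp_score_apply hθ hη c).const_mul _

lemma IsRegular.integral_inner_effScore (hM : M.IsRegular) (hθ : θ ∈ M.Θ) (hη : η ∈ M.Λ)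
    (t : EuclideanSpace ℝ (Fin k)) : ∫ y, ⟪t, M.effScore θ η y⟫ ∂(M.G θ η) = 0 := by
  have := M.isProbabilityMeasure_G hθ hη
  have h y : ⟪t, M.effScore θ η y⟫ = ∑ c, M.effCoeff θ η t.ofLp c * M.score θ η y c := by
    rw [← dotProduct, ← dotProduct_effScore]
    simp [PiLp.inner_apply, dotProduct, mul_comm]
  simp only [h]
  rw [integral_finsetSum _ fun c _ =>
    ((hM.memLp_score_apply hθ hη c).integrable one_le_two).const_mul _]
  simp [integral_const_mul, hM.integral_score_eq_zero hθ hη]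

lemma IsRegular.integral_inner_effScore_sq (hM : M.IsRegular) (hθ : θ ∈ M.Θ) (hη : η ∈ M.Λ)
    (t : EuclideanSpace ℝ (Fin k)) :
    ∫ y, ⟪t, M.effScore θ η y⟫ ^ 2 ∂(M.G θ η) = t.ofLp ⬝ᵥ (M.effInfo θ η).mulVec t.ofLp := by
  have := integral_dotProduct_sq (F := fun y => (M.effScore θ η y).ofLp)
    (fun a => (hM.memLp_effScore hθ hη).eval_piLp a) t.ofLp
  rw [effInfo, ← this]
  simp [PiLp.inner_apply, dotProduct, mul_comm]

/-- The efficient information is positive definite. -/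
lemma IsRegular.posDef_effInfo (hM : M.IsRegular) (hθ : θ ∈ M.Θ) (hη : η ∈ M.Λ) :
    (M.effInfo θ η).PosDef := by
  have hF a := (hM.memLp_effScore hθ hη).eval_piLp a
  refine .of_dotProduct_mulVec_pos (posSemidef_moment hF).isHermitian fun v hv => ?_
  rw [star_trivial, effInfo, ← integral_dotProduct_sq hF]
  simp only [dotProduct_effScore]
  rw [integral_dotProduct_sq (hM.memLp_score_apply hθ hη)]
  -- The θ-block of the coefficients is `v` itself.
  have hne : M.effCoeff θ η v ≠ 0 := fun h => hv (funext fun a => congrFun h (.inl a))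
  have := (hM.posDef_fisherInfo hθ hη).dotProduct_mulVec_pos hne
  rwa [star_trivial] at this

end Deconvolution.Model

theorem mainTheorem4 {k m : ℕ} (M : Deconvolution.Model k m) (hM : M.IsRegular)
    (θ₀ : EuclideanSpace ℝ (Fin k)) (hθ₀ : θ₀ ∈ M.Θ)
    (η₀ : EuclideanSpace ℝ (Fin m)) (hη₀ : η₀ ∈ M.Λ)
    -- the estimated scores and the estimate of the inverse efficient information,
    -- both functions of the observations
    (lhat : (n : ℕ) → (Fin n → ℝ) → Fin n → EuclideanSpace ℝ (Fin k))
    (lhat_meas : ∀ n j, Measurable fun y => lhat n y j)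
    (Lhat : (n : ℕ) → (Fin n → ℝ) → Matrix (Fin k) (Fin k) ℝ)
    (Lhat_meas : ∀ n a b, Measurable fun y => Lhat n y a b)
    (hl : M.IsSufficientlyGood θ₀ η₀ lhat)
    (hL : M.IsConsistent θ₀ η₀ Lhat)
    -- the signals `X i` with density `f θ₀` (null hypothesis), the noises `ε i` with density `h η₀`
    {Ω : Type*} [MeasurableSpace Ω] (P : Measure Ω) [IsProbabilityMeasure P]
    (X ε : ℕ → Ω → ℝ)
    (hX : ∀ i, HasLaw (X i) (Deconvolution.densityMeasure (M.f θ₀)) P)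
    (hε : ∀ i, HasLaw (ε i) (Deconvolution.densityMeasure (M.h η₀)) P)
    (h_signal_noise : ∀ i, IndepFun (X i) (ε i) P)
    (h_indep : iIndepFun (fun i ω => (X i ω, ε i ω)) P) :
    TendstoInDistribution
      (fun n ω => Deconvolution.effScoreStatistic lhat Lhat n fun j : Fin n => X j ω + ε j ω)
      atTop (id : ℝ → ℝ) (fun _ => P) (Deconvolution.chiSquare k) := by
  have := M.isProbabilityMeasure_G hθ₀ hη₀
  have := (M.isDensity_f θ₀ hθ₀).isProbabilityMeasure
  have := (M.isDensity_h η₀ hη₀).isProbabilityMeasure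
  have hY (i : ℕ) : HasLaw (fun ω => X i ω + ε i ω) (M.G θ₀ η₀) P := by
    rw [← M.conv_eq_G hθ₀ hη₀]
    exact (h_signal_noise i).hasLaw_fun_add (hX i) (hε i)
  have hindep : iIndepFun (fun i ω => X i ω + ε i ω) P :=
    h_indep.comp (fun _ p => p.1 + p.2) fun _ => by fun_prop
  have hlim := Deconvolution.tendstoInDistribution_effScoreStatistic (hM.posDef_effInfo hθ₀ hη₀)
    (hM.memLp_effScore hθ₀ hη₀) (hM.integral_inner_effScore hθ₀ hη₀)
    (hM.integral_inner_effScore_sq hθ₀ hη₀) lhat_meas Lhat_meas hl hL hY hindep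
  exact hlim
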